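/- Let $\mathbb{F}_q$ be a finite field with $q$ elements, let $\sigma\in\mathrm{Aut}(\mathbb{F}_q)$, and let $R=\mathbb{F}_q[X;\sigma]/(X^2)$ be the truncated skew polynomial ring, where $Xa=\sigma(a)X$ for $a\in\mathbb{F}_q$. A \emph{point} of $\mathrm{Barb}(R^3_R)$ is a submodule $xR$ of the right module $R^3_R$ such that $\varphi(x)=1$ for some $\varphi\in\mathrm{Hom}(R^3_R,R_R)$. Let $S\le \mathrm{PGL}(3,\mathbb{F}_q)$ be a Singer cycle, i.e. a cyclic subgroup acting regularly on the points of $\mathrm{PG}(2,q)$. Let $p$ be a point of $\mathrm{Barb}(R^3_R)$, and let $K$ be the orbit of $p$ under all matrices $g\in\mathrm{GL}(3,\mathbb{F}_q)\subseteq \mathrm{GL}(3,R)$ whose class in $\mathrm{PGL}(3,\mathbb{F}_q)$ lies in $S$. Then $K$ consists of points of $\mathrm{Barb}(R^3_R)$, and $|K|=q^2+q+1$ if and only if $\sigma=\mathrm{id}$ or $p=vR$ for some $v\in\mathbb{F}_q^3$. The ring $R$ has a unique normalized left homogeneous weight $\mathrm{w}_{\mathrm{hom}}$, i.e. a unique map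 $w:R\to\mathbb{R}_{\ge 0}$ with $w(0)=0$, with $w(x)=w(y)$ whenever $Rx=Ry$, and with $\sum_{y\in Rx}w(y)=|Rx|$ for all $x\ne 0$; it is extended to $R^n$ by $w(c)=\sum_i w(c_i)$. Let $Y$ be a $3\times(q^2+q+1)$ matrix over $R$ whose columns generate the points of $K$, each point exactly once (so that $|K|=q^2+q+1$). Then the rows of $Y$ are left linearly independent, so that the left linear code $C\le {}_RR^{q^2+q+1}$ generated by them is a $[q^2+q+1,3]$ code (free of rank $3$), and $C$ is a two-weight code with weights $$w_1=\frac{q^3}{q-1}\quad\text{and}\quad w_2=q^2,$$ that is, every nonzero word of $C$ has positive weight, $w_1\neq w_2$, and the set of nonzero values of $\mathrm{w}_{\mathrm{hom}}$ on $C$ is exactly $\{w_1,w_2\}$. -/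

import Mathlib

open scoped MatrixGroups LinearAlgebra.Projectivization

/-! ### The truncated skew polynomial ring `F[X; σ] / (X ^ 2)` -/

/-- The action of `ℕ` on `F` through the iterates of `σ`; in the resulting ring
`SkewPolynomial F` one has `X * a = σ a * X`. -/
abbrev skewAction {F : Type*} [Semiring F] (σ : F ≃+* F) :
    MulSemiringAction (Multiplicative ℕ) F :=
  MulSemiringAction.compHom F (powersHom (RingAut F) σ)

/-- The ring `F[X; σ] / (X ^ 2)`: the skew polynomial ring with `X * a = σ a * X`, modulo the
two-sided ideal generated by `X ^ 2`. -/
def TruncSkewPoly {F : Type*} [Field F] (σ : F ≃+* F) : Type _ :=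
  letI := skewAction σ
  (TwoSidedIdeal.span {(SkewPolynomial.X ^ 2 : SkewPolynomial F)}).ringCon.Quotient

namespace TruncSkewPoly

noncomputable instance {F : Type*} [Field F] (σ : F ≃+* F) : Ring (TruncSkewPoly σ) :=
  letI := skewAction σ
  inferInstanceAs
    (Ring (TwoSidedIdeal.span {(SkewPolynomial.X ^ 2 : SkewPolynomial F)}).ringCon.Quotient)

/-- The inclusion of the coefficient field `F` into `F[X; σ] / (X ^ 2)`. -/
noncomputable def const {F : Type*} [Field F] (σ : F ≃+* F) : F →+* TruncSkewPoly σ :=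
  letI := skewAction σ
  (TwoSidedIdeal.span {(SkewPolynomial.X ^ 2 : SkewPolynomial F)}).ringCon.mk'.comp
    SkewPolynomial.CRingHom

end TruncSkewPoly

/-! ### Points of Barbilian spaces; right `R`-modules are modules over `Rᵐᵒᵖ` -/

/-- The points of the Barbilian space of the right `R`-module `M`: the submodules `xR` such that
`φ x = 1` for some `φ` in the dual `Hom(M_R, R_R)`. -/
def barbPoints (R M : Type*) [Ring R] [AddCommGroup M] [Module Rᵐᵒᵖ M] :
    Set (Submodule Rᵐᵒᵖ M) :=
  {p | ∃ x : M, (∃ φ : M →ₗ[Rᵐᵒᵖ] R, φ x = 1) ∧ p = Submodule.span Rᵐᵒᵖ {x}}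

/-! ### Singer cycles and their orbits -/

/-- A Singer cycle of `PGL(3, F)`: a cyclic subgroup that acts regularly (sharply transitively) on
the points of the projective plane over `F`. -/
def IsSingerCycle {F : Type*} [Field F] (S : Subgroup PGL(3, F)) : Prop :=
  IsCyclic S ∧ ∀ P Q : ℙ F (Fin 3 → F), ∃! s : PGL(3, F), s ∈ S ∧ s • P = Q

/-- The right-linear map of `R ^ 3` (column vectors), `R = F[X; σ] / (X ^ 2)`, given by left
multiplication with an invertible matrix over `F`, read as a matrix over `R`. -/
noncomputable def embeddedGL {F : Type*} [Field F] (σ : F ≃+* F) (g : GL (Fin 3) F) :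
    (Fin 3 → TruncSkewPoly σ) →ₗ[(TruncSkewPoly σ)ᵐᵒᵖ] (Fin 3 → TruncSkewPoly σ) :=
  Matrix.mulVecBilin (TruncSkewPoly σ) (TruncSkewPoly σ)ᵐᵒᵖ
    ((g : Matrix (Fin 3) (Fin 3) F).map (TruncSkewPoly.const σ))

/-- The orbit of `p` under the matrices in `GL(3, F)` whose class in `PGL(3, F)` lies in `S`. -/
def embeddedOrbit {F : Type*} [Field F] (σ : F ≃+* F) (S : Subgroup PGL(3, F))
    (p : Submodule (TruncSkewPoly σ)ᵐᵒᵖ (Fin 3 → TruncSkewPoly σ)) :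
    Set (Submodule (TruncSkewPoly σ)ᵐᵒᵖ (Fin 3 → TruncSkewPoly σ)) :=
  {p' | ∃ g : GL (Fin 3) F, Matrix.ProjGenLinGroup.mk g ∈ S ∧ p' = p.map (embeddedGL σ g)}

/-! ### Homogeneous weights and two-weight codes -/

/-- `w` is a normalized (average value `1`) left homogeneous weight on the finite ring `R`.
`Ideal.span {x}` is the principal left ideal `Rx`. -/
structure IsNormalizedHomogeneousWeight {R : Type*} [Ring R] (w : R → ℝ) : Prop where
  map_zero : w 0 = 0
  nonneg : ∀ x, 0 ≤ w x
  eq_of_span_eq : ∀ x y : R, (Ideal.span {x} : Ideal R) = Ideal.span {y} → w x = w y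
  sum_span : ∀ x : R, x ≠ 0 →
    ∑ᶠ y ∈ (Ideal.span {x} : Ideal R), w y = (Nat.card (Ideal.span {x} : Ideal R) : ℝ)

/-- The additive extension of a weight on `R` to `R ^ n`. -/
def wordWeight {R : Type*} {n : ℕ} (w : R → ℝ) (c : Fin n → R) : ℝ :=
  ∑ i, w (c i)

/-- The left linear code generated by the rows of `Y`. -/
def rowCode {R : Type*} [Ring R] {k n : ℕ} (Y : Matrix (Fin k) (Fin n) R) :
    Submodule R (Fin n → R) :=
  Submodule.span R (Set.range Y.row)

/-- `C` is a two-weight code with weights `w₁` and `w₂` with respect to `w`: it is proper (nonzero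
words have positive weight), and `w₁`, `w₂` are exactly the two nonzero values of `w` on `C`. -/
def IsTwoWeightCode {R : Type*} [Ring R] {n : ℕ} (w : R → ℝ) (C : Submodule R (Fin n → R))
    (w₁ w₂ : ℝ) : Prop :=
  (∀ c ∈ C, c ≠ 0 → 0 < wordWeight w c) ∧
    w₁ ≠ w₂ ∧ {t : ℝ | t ≠ 0 ∧ ∃ c ∈ C, wordWeight w c = t} = {w₁, w₂}

/-! Every element of R is uniquely a + bX, and the only left ideals are 0, the radical FX and R. A
homogeneous weight is thus given by its value on units and its value on nonzero radical elements,
and the two averaging conditions force 1 and q/(q-1).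

Write a generator of p as x = u + vX with u ≠ 0. The preimage of S in GL(3, F) is abelian,
transitive on nonzero vectors, and only its scalars have eigenvectors in F³. Hence gx ↦ [gu] maps
the orbit onto PG(2, q), and the orbit has q² + q + 1 points exactly when scalar matrices c fix p.
Left multiplication gives cu + cvX, right multiplication gives cu + σ(c)vX; they generate the same
point for all c only if σ = id or v is a multiple of u, in which case the X-part can be removed
(`ncard_embeddedOrbit_iff`).

In the good case choose H commuting with the Singer group and Hu = v (`exists_commuting_matrix`), so
that gx = z + (Hz)X with z = gu. For a row combination with coefficients a + bX the entry at z is,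
up to a unit, a·z + (a·Hz + b·σ(z))X. Its weight is invariant under scaling z, so q-1 times the word
weight is the sum over all z in F³ (`card_sub_one_mul_wordWeight`). Equidistribution of additive
maps evaluates this sum: (q-1)q² if a ≠ 0 and the X-part vanishes on the kernel of a, and q³ in the
other nonzero cases. -/

namespace TruncSkewPoly

/-! ### Coordinates on F[X; σ]/(X²) from a triangular matrix representation -/

variable {F : Type*} [Field F] (σ : F ≃+* F)

/-- The ring homomorphism `a ↦ diag(a, σ a)`. -/
def diagHom : F →+* Matrix (Fin 2) (Fin 2) F :=
  (Matrix.diagonalRingHom (Fin 2) F).comp (RingHom.pi ![RingHom.id F, (σ : F →+* F)])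

lemma diagHom_apply (a : F) : diagHom σ a = !![a, 0; 0, σ a] := by
  ext i j
  fin_cases i <;> fin_cases j <;> rfl

/-- The skew relation for the images of scalars and of X; it is what lets the two maps extend to the
skew polynomial ring. -/
lemma diagHom_comm (n : Multiplicative ℕ) (a : F) :
    diagHom σ ((σ ^ n.toAdd) a) * (powersHom _ (!![0, 1; 0, 0] : Matrix (Fin 2) (Fin 2) F)) n =
      (powersHom _ (!![0, 1; 0, 0] : Matrix (Fin 2) (Fin 2) F)) n * diagHom σ a := by
  rw [powersHom_apply]
  induction n.toAdd generalizing a with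
  | zero => simp
  | succ k ih =>
    have h1 : (σ ^ (k + 1)) a = (σ ^ k) (σ a) := by rw [pow_succ]; rfl
    have h2 : diagHom σ (σ a) * !![0, 1; 0, 0] = !![0, 1; 0, 0] * diagHom σ a := by
      simp [diagHom_apply]
    rw [h1, pow_succ, ← mul_assoc, ih, mul_assoc, h2, mul_assoc]

/-- The upper triangular matrix representation of the skew polynomial ring in which `X` is a
matrix unit. -/
noncomputable def skewRep :
    letI := skewAction σ
    SkewPolynomial F →+* Matrix (Fin 2) (Fin 2) F :=
  letI := skewAction σ
  SkewMonoidAlgebra.liftNCRingHom (diagHom σ) (powersHom _ !![0, 1; 0, 0])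
    (fun {a n} => diagHom_comm σ n a)

lemma skewRep_monomial (n : ℕ) (a : F) :
    skewRep σ (SkewPolynomial.monomial n a) = diagHom σ a * !![0, 1; 0, 0] ^ n :=
  letI := skewAction σ
  SkewMonoidAlgebra.liftNC_single _ _ _ _

/-- The faithful representation of `F[X; σ] / (X ^ 2)` by upper triangular matrices, in which
`a + b X` is sent to the matrix with rows `(a, b)` and `(0, σ a)`. -/
noncomputable def rep : TruncSkewPoly σ →+* Matrix (Fin 2) (Fin 2) F :=
  letI := skewAction σ
  RingCon.lift _ (skewRep σ) (by
    suffices h : TwoSidedIdeal.span _ ≤ TwoSidedIdeal.ker (skewRep σ) from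
      fun _ _ hxy => TwoSidedIdeal.ringCon_le_iff.mp h hxy
    rw [TwoSidedIdeal.span_le, Set.singleton_subset_iff]
    change _ ∈ TwoSidedIdeal.ker (skewRep σ)
    rw [TwoSidedIdeal.mem_ker, SkewPolynomial.X_pow_eq_monomial, skewRep_monomial]
    simp [pow_two, ← Matrix.ext_iff, Fin.forall_fin_two])

/-- The projection from the skew polynomial ring. -/
noncomputable def proj :
    letI := skewAction σ
    SkewPolynomial F →+* TruncSkewPoly σ :=
  letI := skewAction σ
  (TwoSidedIdeal.span {(SkewPolynomial.X ^ 2 : SkewPolynomial F)}).ringCon.mk'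

lemma proj_surjective :
    letI := skewAction σ
    Function.Surjective (proj σ) :=
  let := skewAction σ
  RingCon.mk'_surjective _

/-- The class of the variable `X`. -/
noncomputable def X : TruncSkewPoly σ :=
  letI := skewAction σ
  proj σ SkewPolynomial.X

lemma rep_const (a : F) : rep σ (const σ a) = !![a, 0; 0, σ a] := by
  let := skewAction σ
  change skewRep σ (SkewPolynomial.monomial 0 a) = _
  rw [skewRep_monomial, pow_zero, mul_one, diagHom_apply]

lemma rep_X : rep σ (X σ) = !![0, 1; 0, 0] := by
  let := skewAction σ
  change skewRep σ (SkewPolynomial.monomial 1 1) = _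
  simp [skewRep_monomial]

lemma exists_eq (r : TruncSkewPoly σ) : ∃ a b : F, r = const σ a + const σ b * X σ := by
  let := skewAction σ
  have hX : X σ ^ 2 = 0 := by
    rw [X, ← map_pow, ← TwoSidedIdeal.mem_ker]
    refine (TwoSidedIdeal.ker_ringCon_mk' _).ge ?_
    exact TwoSidedIdeal.subset_span rfl
  obtain ⟨f, rfl⟩ := proj_surjective σ r
  induction f using SkewPolynomial.induction with
  | h0 => exact ⟨0, 0, by simp⟩
  | ha n c f _ _ ih =>
    obtain ⟨a, b, h⟩ := ih
    have hm : proj σ (SkewPolynomial.monomial n c) = const σ c * X σ ^ n := by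
      rw [← SkewPolynomial.C_mul_X_pow_eq_monomial, map_mul, map_pow]
      rfl
    rw [map_add, h, hm]
    match n with
    | 0 => exact ⟨c + a, b, by simp [add_assoc]⟩
    | 1 => exact ⟨a, c + b, by simp [add_mul]; abel⟩
    | n + 2 => exact ⟨a, b, by simp [pow_add, hX]⟩

/-- The constant coefficient. -/
noncomputable def fst : TruncSkewPoly σ →+* F where
  toFun r := rep σ r 0 0
  map_one' := by simp
  map_zero' := by simp
  map_add' := by simp
  map_mul' r s := by
    obtain ⟨a, b, rfl⟩ := exists_eq σ r
    obtain ⟨c, d, rfl⟩ := exists_eq σ s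
    simp [rep_const, rep_X]

/-- The coefficient of `X`. -/
noncomputable def snd : TruncSkewPoly σ →+ F where
  toFun r := rep σ r 0 1
  map_zero' := by simp
  map_add' := by simp

/-- The element `a + b X`. -/
noncomputable def pair (a b : F) : TruncSkewPoly σ := const σ a + const σ b * X σ

@[simp] lemma fst_pair (a b : F) : fst σ (pair σ a b) = a := by
  simp [fst, pair, rep_const, rep_X]

@[simp] lemma snd_pair (a b : F) : snd σ (pair σ a b) = b := by
  simp [snd, pair, rep_const, rep_X]

@[simp] lemma fst_const (a : F) : fst σ (const σ a) = a := by
  simp [fst, rep_const]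

@[simp] lemma snd_const (a : F) : snd σ (const σ a) = 0 := by
  simp [snd, rep_const]

@[simp] lemma pair_fst_snd (r : TruncSkewPoly σ) : pair σ (fst σ r) (snd σ r) = r := by
  obtain ⟨a, b, h⟩ := exists_eq σ r
  rw [← pair] at h
  simp [h]

variable {σ} in
lemma ext {r s : TruncSkewPoly σ} (h₁ : fst σ r = fst σ s) (h₂ : snd σ r = snd σ s) : r = s := by
  rw [← pair_fst_snd σ r, ← pair_fst_snd σ s, h₁, h₂]

@[simp] lemma snd_one : snd σ 1 = 0 := by simp [snd]

@[simp] lemma snd_mul (r s : TruncSkewPoly σ) :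
    snd σ (r * s) = fst σ r * snd σ s + snd σ r * σ (fst σ s) := by
  obtain ⟨a, b, rfl⟩ := exists_eq σ r
  obtain ⟨c, d, rfl⟩ := exists_eq σ s
  simp [fst, snd, rep_const, rep_X]

/-- Additive coordinates on `F[X; σ] / (X ^ 2)`. -/
noncomputable def coordEquiv : TruncSkewPoly σ ≃ F × F where
  toFun r := (fst σ r, snd σ r)
  invFun x := pair σ x.1 x.2
  left_inv r := by simp
  right_inv x := by simp

end TruncSkewPoly

/-! ### Left ideals and the homogeneous weight -/

namespace TruncSkewPoly

variable {F : Type*} [Field F] (σ : F ≃+* F)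

lemma span_eq_top {x : TruncSkewPoly σ} (hx : fst σ x ≠ 0) :
    (Ideal.span {x} : Ideal (TruncSkewPoly σ)) = ⊤ := by
  rw [Ideal.eq_top_iff_one, Ideal.mem_span_singleton']
  -- The left inverse of a + bX is a⁻¹ - a⁻¹bσ(a)⁻¹X.
  exact ⟨pair σ (fst σ x)⁻¹ (-(fst σ x)⁻¹ * snd σ x * (σ (fst σ x))⁻¹),
    ext (by simp [hx]) (by simp [hx])⟩

lemma mem_span_of_fst_eq_zero {x y : TruncSkewPoly σ} (hx : fst σ x = 0) (hx' : snd σ x ≠ 0) :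
    y ∈ (Ideal.span {x} : Ideal (TruncSkewPoly σ)) ↔ fst σ y = 0 := by
  rw [Ideal.mem_span_singleton']
  constructor
  · rintro ⟨a, rfl⟩
    simp [hx]
  · exact fun hy => ⟨pair σ (snd σ y / snd σ x) 0, ext (by simp [hx, hy]) (by simp [hx, hx'])⟩

/-- The maximal ideal is parametrized by the coefficient of `X`. -/
noncomputable def radicalEquiv {x : TruncSkewPoly σ} (hx : fst σ x = 0) (hx' : snd σ x ≠ 0) :
    F ≃ (Ideal.span {x} : Ideal (TruncSkewPoly σ)) where
  toFun b := ⟨pair σ 0 b, (mem_span_of_fst_eq_zero σ hx hx').mpr (by simp)⟩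
  invFun y := snd σ y
  left_inv b := by simp
  right_inv y := Subtype.ext <| ext
    (by simpa using ((mem_span_of_fst_eq_zero σ hx hx').mp y.2).symm) (by simp)

lemma finsum_mem_radical [Fintype F] {x : TruncSkewPoly σ} (hx : fst σ x = 0)
    (hx' : snd σ x ≠ 0) (f : TruncSkewPoly σ → ℝ) :
    ∑ᶠ y ∈ (Ideal.span {x} : Ideal (TruncSkewPoly σ)), f y = ∑ b : F, f (pair σ 0 b) := by
  rw [← finsum_eq_sum_of_fintype, ← finsum_subtype_eq_finsum_cond]
  exact (finsum_comp_equiv (radicalEquiv σ hx hx')).symm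

lemma finsum_eq_sum_pair [Fintype F] (f : TruncSkewPoly σ → ℝ) :
    ∑ᶠ y, f y = ∑ a : F, ∑ b : F, f (pair σ a b) := by
  rw [← Fintype.sum_prod_type', ← finsum_eq_sum_of_fintype]
  exact (finsum_comp_equiv (coordEquiv σ).symm).symm

lemma finsum_mem_span_of_fst_ne_zero [Fintype F] {x : TruncSkewPoly σ} (hx : fst σ x ≠ 0)
    (f : TruncSkewPoly σ → ℝ) :
    ∑ᶠ y ∈ (Ideal.span {x} : Ideal (TruncSkewPoly σ)), f y = ∑ a : F, ∑ b : F, f (pair σ a b) := by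
  rw [span_eq_top σ hx, ← finsum_eq_sum_pair]
  simp

lemma card_span_of_fst_ne_zero {x : TruncSkewPoly σ} (hx : fst σ x ≠ 0) :
    Nat.card (Ideal.span {x} : Ideal (TruncSkewPoly σ)) = Nat.card F ^ 2 := by
  rw [span_eq_top σ hx, Nat.card_congr Submodule.topEquiv.toEquiv, Nat.card_congr (coordEquiv σ),
    Nat.card_prod, pow_two]

/-- The weight of `a + b X`: the value is `u` on units, `t` on nonzero nonunits. -/
noncomputable def stepWeight (u t : ℝ) (a b : F) : ℝ :=
  open Classical in if a = 0 then if b = 0 then 0 else t else u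

lemma stepWeight_of_ne_zero (u t : ℝ) {a : F} (b : F) (ha : a ≠ 0) : stepWeight u t a b = u :=
  if_neg ha

lemma stepWeight_zero_of_ne_zero (u t : ℝ) {b : F} (hb : b ≠ 0) : stepWeight u t 0 b = t := by
  simp [stepWeight, hb]

@[simp] lemma stepWeight_zero_zero (u t : ℝ) : stepWeight u t (0 : F) 0 = 0 := by
  simp [stepWeight]

lemma stepWeight_congr (u t : ℝ) {a b a' b' : F} (ha : a = 0 ↔ a' = 0) (hb : b = 0 ↔ b' = 0) :
    stepWeight u t a b = stepWeight u t a' b' := by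
  by_cases h : a' = 0 <;> by_cases h' : b' = 0 <;> simp [stepWeight, h, h', ha, hb]

lemma sum_stepWeight_zero [Fintype F] (u t : ℝ) :
    ∑ b : F, stepWeight u t 0 b = ((Nat.card F : ℝ) - 1) * t := by
  classical
  rw [← Finset.add_sum_erase _ _ (Finset.mem_univ (0 : F)), stepWeight_zero_zero, zero_add,
    Finset.sum_congr rfl
      (fun b hb => stepWeight_zero_of_ne_zero u t (Finset.ne_of_mem_erase hb)),
    Finset.sum_const, Finset.card_erase_of_mem (Finset.mem_univ _), Finset.card_univ,
    Nat.card_eq_fintype_card, nsmul_eq_mul, Nat.cast_pred Fintype.card_pos]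

lemma sum_stepWeight [Fintype F] (u t : ℝ) :
    ∑ a : F, ∑ b : F, stepWeight u t a b =
      ((Nat.card F : ℝ) - 1) * t + ((Nat.card F : ℝ) - 1) * (Nat.card F * u) := by
  classical
  rw [← Finset.add_sum_erase _ _ (Finset.mem_univ (0 : F)), sum_stepWeight_zero,
    Finset.sum_congr rfl (fun a ha => Finset.sum_congr rfl
      (fun b _ => stepWeight_of_ne_zero u t b (Finset.ne_of_mem_erase ha))),
    Finset.sum_const, Finset.card_erase_of_mem (Finset.mem_univ _), Finset.card_univ,
    Finset.sum_const, Finset.card_univ, Nat.card_eq_fintype_card, nsmul_eq_mul, nsmul_eq_mul,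
    Nat.cast_pred Fintype.card_pos]

/-- The normalized homogeneous weight. -/
noncomputable def homWeight (r : TruncSkewPoly σ) : ℝ :=
  stepWeight 1 (Nat.card F / ((Nat.card F : ℝ) - 1)) (fst σ r) (snd σ r)

lemma card_sub_one_pos (F : Type*) [Field F] [Finite F] : 0 < (Nat.card F : ℝ) - 1 := by
  have : (1 : ℝ) < Nat.card F := by exact_mod_cast Finite.one_lt_card
  linarith

lemma card_radical {x : TruncSkewPoly σ} (hx : fst σ x = 0) (hx' : snd σ x ≠ 0) :
    Nat.card (Ideal.span {x} : Ideal (TruncSkewPoly σ)) = Nat.card F :=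
  (Nat.card_congr (radicalEquiv σ hx hx')).symm

lemma isNormalizedHomogeneousWeight_homWeight [Finite F] :
    IsNormalizedHomogeneousWeight (homWeight σ) where
  map_zero := by simp [homWeight]
  nonneg x := by
    have := card_sub_one_pos F
    unfold homWeight stepWeight
    split_ifs <;> positivity
  eq_of_span_eq x y h := by
    have hiff : fst σ x = 0 ↔ fst σ y = 0 := by
      have key : ∀ {x y : TruncSkewPoly σ}, (Ideal.span {x} : Ideal (TruncSkewPoly σ)) =
          Ideal.span {y} → fst σ x = 0 → fst σ y = 0 := by
        intro x y h hx
        obtain ⟨a, rfl⟩ := Ideal.mem_span_singleton'.mp (h ▸ Ideal.mem_span_singleton_self y)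
        simp [hx]
      exact ⟨key h, key h.symm⟩
    have hiff' : x = 0 ↔ y = 0 := by
      rw [← Ideal.span_singleton_eq_bot, h, Ideal.span_singleton_eq_bot]
    by_cases hx : fst σ x = 0
    · have hy : fst σ y = 0 := hiff.mp hx
      have hs : snd σ x = 0 ↔ snd σ y = 0 := by
        have h0 : ∀ {z : TruncSkewPoly σ}, fst σ z = 0 → (snd σ z = 0 ↔ z = 0) := by
          intro z hz
          exact ⟨fun h => ext (by simpa using hz) (by simpa using h), fun h => by simp [h]⟩
        rw [h0 hx, h0 hy, hiff']
      exact stepWeight_congr _ _ hiff hs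
    · rw [homWeight, homWeight, stepWeight_of_ne_zero _ _ _ hx,
        stepWeight_of_ne_zero _ _ _ ((not_congr hiff).mp hx)]
  sum_span x hx := by
    have := Fintype.ofFinite F
    have hq := (card_sub_one_pos F).ne'
    by_cases h : fst σ x = 0
    · have h' : snd σ x ≠ 0 := fun h' => hx (ext (by simpa using h) (by simpa using h'))
      rw [finsum_mem_radical σ h h', card_radical σ h h']
      simp only [homWeight, fst_pair, snd_pair, sum_stepWeight_zero]
      field_simp
    · rw [finsum_mem_span_of_fst_ne_zero σ h, card_span_of_fst_ne_zero σ h]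
      simp only [homWeight, fst_pair, snd_pair, sum_stepWeight]
      push_cast
      field_simp
      ring

/-- There are only two nonzero principal left ideals, so `w` has one value on units and one on
nonzero radical elements. The averaging condition on the radical determines the latter, then the one
on R the former. -/
lemma eq_homWeight [Finite F] {w : TruncSkewPoly σ → ℝ}
    (hw : IsNormalizedHomogeneousWeight w) : w = homWeight σ := by
  have := Fintype.ofFinite F
  have hq := (card_sub_one_pos F).ne'
  have hq' : (Nat.card F : ℝ) ≠ 0 := by exact_mod_cast Nat.card_pos.ne'
  obtain ⟨t, ht⟩ : ∃ t, w (pair σ 0 1) = t := ⟨_, rfl⟩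
  have hstep : ∀ a b, w (pair σ a b) = stepWeight (w 1) t a b := by
    intro a b
    by_cases ha : a = 0
    · subst ha
      by_cases hb : b = 0
      · rw [hb, stepWeight_zero_zero, ← hw.map_zero]
        exact congrArg w (ext (by simp) (by simp))
      · rw [stepWeight_zero_of_ne_zero _ _ hb, ← ht]
        refine hw.eq_of_span_eq _ _ (Ideal.ext fun y => ?_)
        rw [mem_span_of_fst_eq_zero σ (by simp) (by simpa using hb),
          mem_span_of_fst_eq_zero σ (by simp) (by simp)]
    · rw [stepWeight_of_ne_zero _ _ _ ha]
      refine hw.eq_of_span_eq _ _ ?_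
      rw [span_eq_top σ (by simpa using ha), span_eq_top σ (by simp)]
  have hX : pair σ 0 1 ≠ 0 := fun h => by simpa using congrArg (snd σ) h
  have h1 := hw.sum_span _ hX
  rw [finsum_mem_radical σ (by simp) (by simp), card_radical σ (by simp) (by simp)] at h1
  simp only [hstep, sum_stepWeight_zero] at h1
  have h2 := hw.sum_span 1 (fun h => by simpa using congrArg (fst σ) h)
  rw [finsum_mem_span_of_fst_ne_zero σ (by simp), card_span_of_fst_ne_zero σ (by simp)] at h2
  simp only [hstep, sum_stepWeight, h1] at h2
  have ht' : t = Nat.card F / ((Nat.card F : ℝ) - 1) := by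
    rw [eq_div_iff hq, mul_comm, h1]
  have hu : w 1 = 1 := by
    push_cast at h2
    have : ((Nat.card F : ℝ) - 1) * Nat.card F * (w 1 - 1) = 0 := by linear_combination h2
    exact sub_eq_zero.mp ((mul_eq_zero.mp this).resolve_left (mul_ne_zero hq hq'))
  funext r
  rw [← pair_fst_snd σ r, hstep, ht', hu]
  simp [homWeight]

/-- Makes the weight of a codeword entry independent of the generator chosen for the corresponding
point. -/
lemma homWeight_mul_of_fst_ne_zero (r : TruncSkewPoly σ) {s : TruncSkewPoly σ}
    (hs : fst σ s ≠ 0) : homWeight σ (r * s) = homWeight σ r := by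
  by_cases hr : fst σ r = 0
  · exact stepWeight_congr _ _ (by simp [hs]) (by simp [hr, hs])
  · rw [homWeight, homWeight, stepWeight_of_ne_zero _ _ _ hr,
      stepWeight_of_ne_zero _ _ _ (by simp [hr, hs])]

end TruncSkewPoly

/-! ### The preimage of a Singer cycle in GL(3, F) -/

section Singer

variable {F : Type*} [Field F]

/-- The preimage in `GL(3, F)` of a subgroup of `PGL(3, F)`. -/
def liftGL (S : Subgroup PGL(3, F)) : Subgroup (GL (Fin 3) F) :=
  S.comap Matrix.ProjGenLinGroup.mk

lemma scalar_mem_liftGL (S : Subgroup PGL(3, F)) (c : Fˣ) :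
    Matrix.GeneralLinearGroup.scalar (Fin 3) c ∈ liftGL S := by
  simp [liftGL, S.one_mem]

namespace IsSingerCycle

variable {S : Subgroup PGL(3, F)}
-- A central extension of a cyclic group is abelian; here the kernel consists of scalars.
lemma commute (hS : IsSingerCycle S) {g h : GL (Fin 3) F} (hg : g ∈ liftGL S)
    (hh : h ∈ liftGL S) : g * h = h * g := by
  have := hS.1
  let f : liftGL S →* S := Matrix.ProjGenLinGroup.mk.subgroupComap S
  have hf : f.ker ≤ Subgroup.center (liftGL S) := by
    intro k hk
    have hk' : (k : GL (Fin 3) F) ∈ Subgroup.center (GL (Fin 3) F) := by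
      rw [← Matrix.ProjGenLinGroup.mk_eq_one]
      exact congrArg Subtype.val hk
    exact Subgroup.mem_center_iff.mpr fun l =>
      Subtype.ext (Subgroup.mem_center_iff.mp hk' l)
  have := f.isMulCommutative_of_isCyclic_of_ker_le_center hf
  exact congrArg Subtype.val (mul_comm' (⟨g, hg⟩ : liftGL S) ⟨h, hh⟩)

lemma exists_mulVec_eq (hS : IsSingerCycle S) {u v : Fin 3 → F} (hu : u ≠ 0) (hv : v ≠ 0) :
    ∃ g ∈ liftGL S, g.val.mulVec u = v := by
  obtain ⟨s, ⟨hs, hsu⟩, -⟩ := hS.2 (Projectivization.mk F u hu) (Projectivization.mk F v hv)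
  obtain ⟨g, rfl⟩ := Matrix.ProjGenLinGroup.mk_surjective s
  rw [Projectivization.PGL.mk_smul_mk, Projectivization.mk_eq_mk_iff] at hsu
  obtain ⟨c, hc⟩ := hsu
  refine ⟨Matrix.GeneralLinearGroup.scalar (Fin 3) c⁻¹ * g,
    mul_mem (scalar_mem_liftGL S _) hs, ?_⟩
  have hc' : c • v = g.val.mulVec u := hc
  rw [Units.val_mul, ← Matrix.mulVec_mulVec, ← hc']
  ext i
  simp [-map_inv, Units.smul_def]

/-- An eigenvector is a fixed point of the plane, so regularity makes the class of `g` trivial. -/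
lemma val_eq_smul_one (hS : IsSingerCycle S) {g : GL (Fin 3) F} (hg : g ∈ liftGL S)
    {u : Fin 3 → F} (hu : u ≠ 0) {c : F} (h : g.val.mulVec u = c • u) : g.val = c • (1 : Matrix (Fin 3) (Fin 3) F) := by
  have hgu : g • u ≠ 0 := (smul_ne_zero_iff_ne g).mpr hu
  have hc : c ≠ 0 := by
    rintro rfl
    exact hgu (h.trans (zero_smul _ _))
  have h1 : Matrix.ProjGenLinGroup.mk g = 1 := by
    refine (hS.2 (Projectivization.mk F u hu) (Projectivization.mk F u hu)).unique
      ⟨hg, ?_⟩ ⟨S.one_mem, one_smul _ _⟩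
    rw [Projectivization.PGL.mk_smul_mk, Projectivization.mk_eq_mk_iff]
    exact ⟨Units.mk0 c hc, h.symm⟩
  rw [Matrix.ProjGenLinGroup.mk_eq_one, Matrix.GeneralLinearGroup.center_eq_range_scalar] at h1
  obtain ⟨d, rfl⟩ := h1
  have hd : (d : F) • u = c • u := by
    rw [← h]
    simp
  have : (d : F) = c := smul_left_injective F hu hd
  rw [← this]
  ext i j
  simp [Matrix.one_apply, Matrix.diagonal_apply]

end IsSingerCycle

end Singer

/-! ### The orbit and its projection to the projective plane -/

/-- If the fibers of `f` refine those of the surjection `π`, the range of `f` is as large as the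
range of `π` exactly if the fibers coincide. -/
lemma ncard_range_eq_iff {A B C : Type*} [Finite A] {f : A → B} {π : A → C}
    (hπ : Function.Surjective π) (h : ∀ a b, f a = f b → π a = π b) :
    (Set.range f).ncard = Nat.card C ↔ ∀ a b, π a = π b → f a = f b := by
  let φ : Set.range f → C := fun y => π y.2.choose
  have hφ : ∀ a, φ ⟨f a, a, rfl⟩ = π a := fun a =>
    h _ _ (Set.mem_range_self a).choose_spec
  have hsurj : Function.Surjective φ := fun c => by
    obtain ⟨a, rfl⟩ := hπ c
    exact ⟨_, hφ a⟩
  rw [← Nat.card_coe_set_eq]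
  constructor
  · intro hcard a b hab
    have hinj := (hsurj.bijective_of_nat_card_le hcard.le).injective
    exact congrArg Subtype.val (hinj ((hφ a).trans (hab.trans (hφ b).symm)))
  · intro hinj
    refine Nat.card_congr (Equiv.ofBijective φ ⟨?_, hsurj⟩)
    rintro ⟨_, a, rfl⟩ ⟨_, b, rfl⟩ hab
    rw [hφ, hφ] at hab
    exact Subtype.ext (hinj a b hab)

namespace TruncSkewPoly

variable {F : Type*} [Field F] (σ : F ≃+* F)

/-- The vector of constant coefficients. -/
noncomputable def vfst (x : Fin 3 → TruncSkewPoly σ) : Fin 3 → F := fun i => fst σ (x i)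

/-- The vector of coefficients of `X`. -/
noncomputable def vsnd (x : Fin 3 → TruncSkewPoly σ) : Fin 3 → F := fun i => snd σ (x i)

variable {σ} in
lemma vext {x y : Fin 3 → TruncSkewPoly σ} (h₁ : vfst σ x = vfst σ y)
    (h₂ : vsnd σ x = vsnd σ y) : x = y :=
  funext fun i => ext (congrFun h₁ i) (congrFun h₂ i)

lemma vfst_pair (a b : Fin 3 → F) : vfst σ (fun i => pair σ (a i) (b i)) = a := by
  ext i
  simp [vfst]

lemma vsnd_pair (a b : Fin 3 → F) : vsnd σ (fun i => pair σ (a i) (b i)) = b := by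
  ext i
  simp [vsnd]

@[simp] lemma vfst_embeddedGL (g : GL (Fin 3) F) (x : Fin 3 → TruncSkewPoly σ) :
    vfst σ (embeddedGL σ g x) = g.val.mulVec (vfst σ x) := by
  ext i
  simp [vfst, embeddedGL, Matrix.mulVec, dotProduct]

@[simp] lemma vsnd_embeddedGL (g : GL (Fin 3) F) (x : Fin 3 → TruncSkewPoly σ) :
    vsnd σ (embeddedGL σ g x) = g.val.mulVec (vsnd σ x) := by
  ext i
  simp [vsnd, embeddedGL, Matrix.mulVec, dotProduct]

@[simp] lemma vfst_op_smul (r : TruncSkewPoly σ) (x : Fin 3 → TruncSkewPoly σ) :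
    vfst σ (MulOpposite.op r • x) = fst σ r • vfst σ x := by
  ext i
  simp [vfst, mul_comm]

@[simp] lemma vsnd_op_smul (r : TruncSkewPoly σ) (x : Fin 3 → TruncSkewPoly σ) :
    vsnd σ (MulOpposite.op r • x) = snd σ r • vfst σ x + σ (fst σ r) • vsnd σ x := by
  ext i
  simp [vfst, vsnd, mul_comm]

lemma exists_op_smul_eq {x y : Fin 3 → TruncSkewPoly σ}
    (h : Submodule.span (TruncSkewPoly σ)ᵐᵒᵖ {y} = Submodule.span (TruncSkewPoly σ)ᵐᵒᵖ {x}) :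
    ∃ r : TruncSkewPoly σ, y = MulOpposite.op r • x := by
  have : y ∈ Submodule.span (TruncSkewPoly σ)ᵐᵒᵖ {x} := h ▸ Submodule.mem_span_singleton_self y
  obtain ⟨r, hr⟩ := Submodule.mem_span_singleton.mp this
  exact ⟨r.unop, hr.symm⟩

lemma span_op_smul {r : TruncSkewPoly σ} (hr : fst σ r ≠ 0) (x : Fin 3 → TruncSkewPoly σ) :
    Submodule.span (TruncSkewPoly σ)ᵐᵒᵖ {MulOpposite.op r • x} =
      Submodule.span (TruncSkewPoly σ)ᵐᵒᵖ {x} := by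
  apply le_antisymm
  · exact (Submodule.span_singleton_le_iff_mem _ _).mpr
      (Submodule.smul_mem _ _ (Submodule.mem_span_singleton_self x))
  · rw [Submodule.span_singleton_le_iff_mem, Submodule.mem_span_singleton]
    have h1 : (1 : TruncSkewPoly σ) ∈ (Ideal.span {r} : Ideal (TruncSkewPoly σ)) :=
      span_eq_top σ hr ▸ Submodule.mem_top
    obtain ⟨s, hs⟩ := Ideal.mem_span_singleton'.mp h1
    -- The left inverse `s` has itself a left inverse, which must equal `r`; hence `s` is two-sided.
    obtain ⟨s', hs'⟩ : ∃ s', r * s' = 1 := by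
      refine ⟨s, ?_⟩
      have h0 : fst σ s * fst σ r = 1 := by simpa using congrArg (fst σ) hs
      have h2 : fst σ s ≠ 0 := left_ne_zero_of_mul_eq_one h0
      have h3 : (1 : TruncSkewPoly σ) ∈ (Ideal.span {s} : Ideal (TruncSkewPoly σ)) :=
        span_eq_top σ h2 ▸ Submodule.mem_top
      obtain ⟨t, ht⟩ := Ideal.mem_span_singleton'.mp h3
      rwa [left_inv_eq_right_inv ht hs] at ht
    exact ⟨MulOpposite.op s', by rw [smul_smul, ← MulOpposite.op_mul, hs']; simp⟩

/-- Otherwise x = yX with y over F, and φ(x) = φ(y)X lies in the radical. -/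
lemma vfst_ne_zero_of_map_eq_one {x : Fin 3 → TruncSkewPoly σ}
    (φ : (Fin 3 → TruncSkewPoly σ) →ₗ[(TruncSkewPoly σ)ᵐᵒᵖ] TruncSkewPoly σ) (h : φ x = 1) :
    vfst σ x ≠ 0 := by
  intro h0
  have hx : x = MulOpposite.op (pair σ 0 1) • fun i => const σ (snd σ (x i)) :=
    vext (by rw [h0]; simp) (by ext i; simp [vsnd])
  rw [hx, map_smul] at h
  simpa using congrArg (fst σ) h

lemma embeddedGL_inv_apply (g : GL (Fin 3) F) (x : Fin 3 → TruncSkewPoly σ) :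
    embeddedGL σ g⁻¹ (embeddedGL σ g x) = x :=
  vext (by simp only [vfst_embeddedGL, Matrix.mulVec_mulVec]; simp)
    (by simp only [vsnd_embeddedGL, Matrix.mulVec_mulVec]; simp)

lemma mulVec_ne_zero (g : GL (Fin 3) F) {u : Fin 3 → F} (hu : u ≠ 0) : g.val.mulVec u ≠ 0 :=
  (smul_ne_zero_iff_ne g).mpr hu

lemma embeddedOrbit_span (S : Subgroup PGL(3, F)) (x : Fin 3 → TruncSkewPoly σ) :
    embeddedOrbit σ S (Submodule.span _ {x}) =
      Set.range fun g : liftGL S => Submodule.span (TruncSkewPoly σ)ᵐᵒᵖ {embeddedGL σ g.1 x} := by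
  ext p
  simp only [embeddedOrbit, Submodule.map_span, Set.image_singleton, Set.mem_ofPred_eq,
    Set.mem_range, Subtype.exists]
  exact ⟨fun ⟨g, hg, h⟩ => ⟨g, hg, h.symm⟩, fun ⟨g, hg, h⟩ => ⟨g, hg, h.symm⟩⟩

lemma embeddedOrbit_subset_barbPoints (S : Subgroup PGL(3, F))
    {p : Submodule (TruncSkewPoly σ)ᵐᵒᵖ (Fin 3 → TruncSkewPoly σ)}
    (hp : p ∈ barbPoints (TruncSkewPoly σ) (Fin 3 → TruncSkewPoly σ)) :
    embeddedOrbit σ S p ⊆ barbPoints (TruncSkewPoly σ) (Fin 3 → TruncSkewPoly σ) := by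
  obtain ⟨x, ⟨φ, hφ⟩, rfl⟩ := hp
  rw [embeddedOrbit_span]
  rintro _ ⟨g, rfl⟩
  exact ⟨_, ⟨φ ∘ₗ embeddedGL σ g.1⁻¹, by rw [LinearMap.comp_apply, embeddedGL_inv_apply, hφ]⟩, rfl⟩

/-- The projection of the orbit of `x` to the points of the projective plane over `F`. -/
noncomputable def orbitProj (S : Subgroup PGL(3, F)) {x : Fin 3 → TruncSkewPoly σ}
    (hx : vfst σ x ≠ 0) (g : liftGL S) : ℙ F (Fin 3 → F) :=
  Projectivization.mk F (g.1.val.mulVec (vfst σ x)) (mulVec_ne_zero g.1 hx)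

lemma orbitProj_eq_of_span_eq {S : Subgroup PGL(3, F)} {x : Fin 3 → TruncSkewPoly σ}
    (hx : vfst σ x ≠ 0) {g h : liftGL S}
    (hgh : Submodule.span (TruncSkewPoly σ)ᵐᵒᵖ {embeddedGL σ g.1 x} =
      Submodule.span (TruncSkewPoly σ)ᵐᵒᵖ {embeddedGL σ h.1 x}) :
    orbitProj σ S hx g = orbitProj σ S hx h := by
  obtain ⟨r, hr⟩ := exists_op_smul_eq σ hgh
  have hr' := congrArg (vfst σ) hr
  rw [vfst_op_smul, vfst_embeddedGL, vfst_embeddedGL] at hr'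
  exact (Projectivization.mk_eq_mk_iff' _ _ _ _ _).mpr ⟨_, hr'.symm⟩

lemma orbitProj_surjective {S : Subgroup PGL(3, F)} (hS : IsSingerCycle S)
    {x : Fin 3 → TruncSkewPoly σ} (hx : vfst σ x ≠ 0) :
    Function.Surjective (orbitProj σ S hx) := by
  intro P
  induction P using Projectivization.ind with | h v hv =>
  obtain ⟨g, hg, hgv⟩ := hS.exists_mulVec_eq hx hv
  exact ⟨⟨g, hg⟩, by simp only [orbitProj, hgv]⟩

/-- If gu = c·hu, then h⁻¹g has an eigenvector and is the scalar c. The condition on the X-part says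
that left and right multiplication by c agree on the generator. -/
lemma span_eq_of_orbitProj_eq {S : Subgroup PGL(3, F)} (hS : IsSingerCycle S)
    {x : Fin 3 → TruncSkewPoly σ} (hx : vfst σ x ≠ 0)
    (hv : ∀ c : F, c • vsnd σ x = σ c • vsnd σ x) {g h : liftGL S}
    (hgh : orbitProj σ S hx g = orbitProj σ S hx h) :
    Submodule.span (TruncSkewPoly σ)ᵐᵒᵖ {embeddedGL σ g.1 x} =
      Submodule.span (TruncSkewPoly σ)ᵐᵒᵖ {embeddedGL σ h.1 x} := by
  obtain ⟨c, hc⟩ := (Projectivization.mk_eq_mk_iff' _ _ _ _ _).mp hgh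
  have hc0 : c ≠ 0 := by
    rintro rfl
    exact mulVec_ne_zero g.1 hx (by rw [← hc, zero_smul])
  have hk : (h⁻¹ * g).1.val = c • (1 : Matrix (Fin 3) (Fin 3) F) := by
    refine hS.val_eq_smul_one (h⁻¹ * g).2 hx ?_
    rw [Subgroup.coe_mul, Subgroup.coe_inv, Units.val_mul, ← Matrix.mulVec_mulVec, ← hc,
      Matrix.mulVec_smul, Matrix.mulVec_mulVec, ← Units.val_mul]
    simp
  have hg : g.1.val = c • h.1.val := by
    have : g = h * (h⁻¹ * g) := by group
    rw [congrArg (fun k : liftGL S => k.1.val) this, Subgroup.coe_mul, Units.val_mul, hk,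
      Matrix.mul_smul, mul_one]
  rw [← span_op_smul σ (r := const σ c) (by simpa using hc0) (embeddedGL σ h.1 x)]
  congr 2
  refine vext ?_ ?_
  · simp [hg, Matrix.smul_mulVec]
  · simp only [vsnd_embeddedGL, vsnd_op_smul, snd_const, fst_const, zero_smul, zero_add, hg,
      Matrix.smul_mulVec]
    rw [← Matrix.mulVec_smul, hv, Matrix.mulVec_smul]

lemma card_projectivePlane [Finite F] :
    Nat.card (ℙ F (Fin 3 → F)) = Nat.card F ^ 2 + Nat.card F + 1 := by
  rw [Projectivization.card_of_finrank F _ (n := 3) (by simp)]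
  simp only [Finset.sum_range_succ, Finset.sum_range_zero]
  ring

lemma ncard_embeddedOrbit_span_iff [Finite F] {S : Subgroup PGL(3, F)} (hS : IsSingerCycle S)
    {x : Fin 3 → TruncSkewPoly σ} (hx : vfst σ x ≠ 0) :
    (embeddedOrbit σ S (Submodule.span _ {x})).ncard = Nat.card F ^ 2 + Nat.card F + 1 ↔
      ∀ g h : liftGL S, orbitProj σ S hx g = orbitProj σ S hx h →
        Submodule.span (TruncSkewPoly σ)ᵐᵒᵖ {embeddedGL σ g.1 x} =
          Submodule.span (TruncSkewPoly σ)ᵐᵒᵖ {embeddedGL σ h.1 x} := by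
  rw [embeddedOrbit_span, ← card_projectivePlane]
  exact ncard_range_eq_iff (orbitProj_surjective σ hS hx) fun _ _ => orbitProj_eq_of_span_eq σ hx

/-- A point that is defined over `F`, or any point if `σ` is the identity, has a generator whose
`X`-part is fixed by `c⁻¹ * σ c` for all `c`. -/
lemma exists_generator {p : Submodule (TruncSkewPoly σ)ᵐᵒᵖ (Fin 3 → TruncSkewPoly σ)}
    (hp : p ∈ barbPoints (TruncSkewPoly σ) (Fin 3 → TruncSkewPoly σ))
    (h : σ = RingEquiv.refl F ∨ ∃ v : Fin 3 → F, p = Submodule.span (TruncSkewPoly σ)ᵐᵒᵖ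
      {fun i => const σ (v i)}) :
    ∃ x : Fin 3 → TruncSkewPoly σ, p = Submodule.span _ {x} ∧ vfst σ x ≠ 0 ∧
      ∀ c : F, c • vsnd σ x = σ c • vsnd σ x := by
  obtain ⟨x, ⟨φ, hφ⟩, rfl⟩ := hp
  have hx := vfst_ne_zero_of_map_eq_one σ φ hφ
  rcases h with rfl | ⟨v, hv⟩
  · exact ⟨x, rfl, hx, fun c => rfl⟩
  · refine ⟨_, hv, ?_, ?_⟩
    · obtain ⟨r, rfl⟩ := exists_op_smul_eq σ hv
      rw [vfst_op_smul] at hx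
      exact right_ne_zero_of_smul hx
    · intro c
      have : vsnd σ (fun i => const σ (v i)) = 0 := by ext i; simp [vsnd]
      rw [this, smul_zero, smul_zero]

lemma ncard_embeddedOrbit_iff [Finite F] {S : Subgroup PGL(3, F)} (hS : IsSingerCycle S)
    {p : Submodule (TruncSkewPoly σ)ᵐᵒᵖ (Fin 3 → TruncSkewPoly σ)}
    (hp : p ∈ barbPoints (TruncSkewPoly σ) (Fin 3 → TruncSkewPoly σ)) :
    (embeddedOrbit σ S p).ncard = Nat.card F ^ 2 + Nat.card F + 1 ↔
      σ = RingEquiv.refl F ∨ ∃ v : Fin 3 → F, p = Submodule.span (TruncSkewPoly σ)ᵐᵒᵖ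
        {fun i => const σ (v i)} := by
  constructor
  · obtain ⟨x, ⟨φ, hφ⟩, rfl⟩ := hp
    have hx := vfst_ne_zero_of_map_eq_one σ φ hφ
    rw [ncard_embeddedOrbit_span_iff σ hS hx, or_iff_not_imp_left]
    intro h hσ
    obtain ⟨c, hc⟩ : ∃ c, σ c ≠ c := by
      by_contra! hc
      exact hσ (RingEquiv.ext hc)
    have hc0 : c ≠ 0 := by
      rintro rfl
      exact hc (map_zero σ)
    -- The scalar c and the identity have the same image in the plane, so cx = xr. Comparing
    -- coefficients gives (c - σ(c))v = `snd σ r` · u.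
    obtain ⟨r, hr⟩ := exists_op_smul_eq σ <|
      h ⟨_, scalar_mem_liftGL S (Units.mk0 c hc0)⟩ 1 <|
        (Projectivization.mk_eq_mk_iff' _ _ _ _ _).mpr ⟨c, by simp⟩
    have h1 := congrArg (vfst σ) hr
    have h2 := congrArg (vsnd σ) hr
    simp at h1 h2
    have hrc : fst σ r = c := (smul_left_injective F hx h1).symm
    rw [hrc, ← sub_eq_iff_eq_add, ← sub_smul] at h2
    have hd : c - σ c ≠ 0 := sub_ne_zero.mpr hc.symm
    have hv : vsnd σ x = (snd σ r / (c - σ c)) • vfst σ x := by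
      rw [div_eq_inv_mul, mul_smul, ← h2, smul_smul, inv_mul_cancel₀ hd, one_smul]
    refine ⟨vfst σ x, ?_⟩
    -- With v = du, right multiplication by the unit 1 - dX removes the X-part.
    rw [← span_op_smul σ (r := pair σ 1 (-(snd σ r / (c - σ c)))) (by simp)]
    congr 2
    refine vext ?_ ?_
    · rw [vfst_op_smul]
      ext i
      simp [vfst]
    · rw [vsnd_op_smul, hv]
      ext i
      simp [vfst, vsnd]
  · intro h
    obtain ⟨x, rfl, hx, hv⟩ := exists_generator σ hp h
    rw [ncard_embeddedOrbit_span_iff σ hS hx]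
    exact fun g h => span_eq_of_orbitProj_eq σ hS hx hv

end TruncSkewPoly

/-! ### Sums of weights over F³ by equidistribution -/

/-- Averages are preserved by surjective homomorphisms of finite groups. -/
lemma AddMonoidHom.card_mul_sum_comp {G A : Type*} [AddCommGroup G] [AddCommGroup A] [Fintype G]
    [Fintype A] (φ : G →+ A) (hφ : Function.Surjective φ) (f : A → ℝ) :
    (Fintype.card A : ℝ) * ∑ g, f (φ g) = Fintype.card G * ∑ a, f a := by
  -- Double counting of f(φ(g) + a): for fixed a, surjectivity absorbs a into g; for fixed g, the
  -- sum over a is a translate.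
  have h₁ : ∑ a : A, ∑ g : G, f (φ g + a) = (Fintype.card A : ℝ) * ∑ g, f (φ g) := by
    rw [← nsmul_eq_mul, ← Finset.card_univ, ← Finset.sum_const]
    refine Finset.sum_congr rfl fun a _ => ?_
    obtain ⟨s, rfl⟩ := hφ a
    simp only [← map_add]
    exact Fintype.sum_equiv (Equiv.addRight s) _ _ fun _ => rfl
  have h₂ : ∑ g : G, ∑ a : A, f (φ g + a) = (Fintype.card G : ℝ) * ∑ a, f a := by
    rw [← nsmul_eq_mul, ← Finset.card_univ, ← Finset.sum_const]
    exact Finset.sum_congr rfl fun g _ =>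
      Fintype.sum_equiv (Equiv.addLeft (φ g)) _ _ fun _ => rfl
  rw [← h₁, ← h₂, Finset.sum_comm]

namespace TruncSkewPoly

variable {F : Type*} [Field F] (σ : F ≃+* F)

/-- The additive map `z ↦ a · H z + b · σ z`. -/
def twistedForm (H : Matrix (Fin 3) (Fin 3) F) (a b : Fin 3 → F) : (Fin 3 → F) →+ F where
  toFun z := a ⬝ᵥ H.mulVec z + b ⬝ᵥ fun i => σ (z i)
  map_zero' := by simp [dotProduct]
  map_add' z z' := by
    simp only [Matrix.mulVec_add, dotProduct, Pi.add_apply, map_add, mul_add,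
      Finset.sum_add_distrib]
    ring

/-- The additive map `z ↦ a · z`. -/
def dotForm (a : Fin 3 → F) : (Fin 3 → F) →+ F where
  toFun z := a ⬝ᵥ z
  map_zero' := by simp
  map_add' := dotProduct_add a

lemma dotForm_smul (a : Fin 3 → F) (c : F) (z : Fin 3 → F) :
    dotForm a (c • z) = c * dotForm a z :=
  dotProduct_smul c a z

lemma dotForm_surjective {a : Fin 3 → F} (ha : a ≠ 0) : Function.Surjective (dotForm a) := by
  intro d
  obtain ⟨i, hi⟩ := Function.ne_iff.mp ha
  exact ⟨Pi.single i ((a i)⁻¹ * d), by simp [dotForm, mul_inv_cancel_left₀ hi]⟩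

section Forms

variable {H : Matrix (Fin 3) (Fin 3) F}

lemma twistedForm_smul
    (hH : ∀ (c : F) (z : Fin 3 → F), c • H.mulVec z = σ c • H.mulVec z) (a b : Fin 3 → F)
    (c : F) (z : Fin 3 → F) :
    twistedForm σ H a b (c • z) = σ c * twistedForm σ H a b z := by
  change a ⬝ᵥ H.mulVec (c • z) + (b ⬝ᵥ fun i => σ (c * z i)) = σ c * (a ⬝ᵥ H.mulVec z + _)
  rw [Matrix.mulVec_smul, hH, dotProduct_smul, mul_add, smul_eq_mul]
  congr 1
  simp [dotProduct, Finset.mul_sum, mul_left_comm]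

variable [Fintype F]

/-- The sum of the weights of `a · z + (a · H z + b · σ z) X` over all vectors `z`. -/
noncomputable def formSum (u t : ℝ) (H : Matrix (Fin 3) (Fin 3) F) (a b : Fin 3 → F) : ℝ :=
  ∑ z : Fin 3 → F, stepWeight u t (dotForm a z) (twistedForm σ H a b z)

lemma formSum_zero_left (u t : ℝ) (H : Matrix (Fin 3) (Fin 3) F) {b : Fin 3 → F} (hb : b ≠ 0) :
    formSum σ u t H 0 b = (Nat.card F : ℝ) ^ 2 * (((Nat.card F : ℝ) - 1) * t) := by
  have hsurj : Function.Surjective (twistedForm σ H 0 b) := by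
    intro d
    obtain ⟨z, hz⟩ := dotForm_surjective hb d
    refine ⟨fun i => σ.symm (z i), ?_⟩
    simpa [twistedForm, dotForm] using hz
  have h := (twistedForm σ H 0 b).card_mul_sum_comp hsurj (fun d => stepWeight u t 0 d)
  rw [sum_stepWeight_zero] at h
  have hq : (Fintype.card F : ℝ) ≠ 0 := by exact_mod_cast Fintype.card_ne_zero
  have h0 : formSum σ u t H 0 b = ∑ z, stepWeight u t 0 (twistedForm σ H 0 b z) := by
    simp [formSum, dotForm]
  rw [h0]
  apply mul_left_cancel₀ hq
  rw [h]
  simp only [Fintype.card_pi, Finset.prod_const, Nat.card_eq_fintype_card, Finset.card_univ,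
    Fintype.card_fin]
  push_cast
  ring

/-- The X-coefficient affects the weight only where a·z = 0, and there it vanishes; only the
equidistribution of a·z is needed. -/
lemma formSum_of_ker_le (u t : ℝ) (H : Matrix (Fin 3) (Fin 3) F) {a b : Fin 3 → F} (ha : a ≠ 0)
    (h : ∀ z, dotForm a z = 0 → twistedForm σ H a b z = 0) :
    formSum σ u t H a b = (Nat.card F : ℝ) ^ 2 * (((Nat.card F : ℝ) - 1) * u) := by
  classical
  have h0 : formSum σ u t H a b = ∑ z, stepWeight u t (dotForm a z) 0 := by
    refine Finset.sum_congr rfl fun z _ => ?_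
    by_cases hz : dotForm a z = 0
    · rw [h z hz]
    · rw [stepWeight_of_ne_zero _ _ _ hz, stepWeight_of_ne_zero _ _ _ hz]
  have h1 := (dotForm a).card_mul_sum_comp (dotForm_surjective ha) (fun d => stepWeight u t d 0)
  have h2 : ∑ d : F, stepWeight u t d 0 = ((Nat.card F : ℝ) - 1) * u := by
    rw [← sum_stepWeight_zero 0 u]
    exact Finset.sum_congr rfl fun d _ => by by_cases hd : d = 0 <;> simp [stepWeight, hd]
  have hq : (Fintype.card F : ℝ) ≠ 0 := by exact_mod_cast Fintype.card_ne_zero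
  rw [h0]
  apply mul_left_cancel₀ hq
  rw [h1, h2]
  simp only [Fintype.card_pi, Finset.prod_const, Nat.card_eq_fintype_card, Finset.card_univ,
    Fintype.card_fin]
  push_cast
  ring

/-- The constant and X-coefficients are jointly surjective onto F × F, so the sum is q times the
total weight of R. -/
lemma formSum_of_not_ker_le (u t : ℝ) {a b : Fin 3 → F}
    (hH : ∀ (c : F) (z : Fin 3 → F), c • H.mulVec z = σ c • H.mulVec z) (ha : a ≠ 0)
    (h : ¬ ∀ z, dotForm a z = 0 → twistedForm σ H a b z = 0) :
    formSum σ u t H a b = (Nat.card F : ℝ) *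
      (((Nat.card F : ℝ) - 1) * t + ((Nat.card F : ℝ) - 1) * (Nat.card F * u)) := by
  push Not at h
  obtain ⟨z₀, hz₀, hne⟩ := h
  have hsurj : Function.Surjective ((dotForm a).prod (twistedForm σ H a b)) := by
    rintro ⟨d, e⟩
    obtain ⟨z, hz⟩ := dotForm_surjective ha d
    -- Adding multiples of `z₀` keeps a·z and moves the twisted form freely; `σ.symm` compensates
    -- its semilinearity.
    refine ⟨z + σ.symm ((e - twistedForm σ H a b z) / twistedForm σ H a b z₀) • z₀, ?_⟩
    refine Prod.ext ?_ ?_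
    · simp [dotForm_smul, hz, hz₀]
    · simp [twistedForm_smul σ hH, hne]
  have h1 := ((dotForm a).prod (twistedForm σ H a b)).card_mul_sum_comp hsurj
    (fun d => stepWeight u t d.1 d.2)
  rw [Fintype.sum_prod_type, sum_stepWeight] at h1
  have hq : (Fintype.card (F × F) : ℝ) ≠ 0 := by exact_mod_cast Fintype.card_ne_zero
  apply mul_left_cancel₀ hq
  rw [formSum]
  refine h1.trans ?_
  simp only [Fintype.card_pi, Finset.prod_const, Nat.card_eq_fintype_card, Finset.card_univ,
    Fintype.card_fin, Fintype.card_prod]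
  push_cast
  ring

end Forms

/-! ### Codeword weights as sums over F³ -/

/-- The generator's `X`-part is the image of its constant part under a matrix that commutes with
the Singer group. -/
lemma exists_commuting_matrix {S : Subgroup PGL(3, F)} (hS : IsSingerCycle S) {u v : Fin 3 → F}
    (hu : u ≠ 0) (hv : ∀ c : F, c • v = σ c • v) :
    ∃ H : Matrix (Fin 3) (Fin 3) F, H.mulVec u = v ∧ (∀ g ∈ liftGL S, g.val * H = H * g.val) ∧
      (∀ (c : F) (z : Fin 3 → F), c • H.mulVec z = σ c • H.mulVec z) ∧
      ∀ a, ∃ b, ∀ z, twistedForm σ H a b z = 0 := by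
  by_cases hv0 : v = 0
  · exact ⟨0, by simp [hv0], by simp, by simp, fun a => ⟨0, by simp [twistedForm]⟩⟩
  · obtain ⟨h, hh, hhu⟩ := hS.exists_mulVec_eq hu hv0
    -- A nonzero X-part forces σ = id. A Singer lift taking u to v then serves as H, and b = -aH
    -- cancels the twisted form.
    have hσ : ∀ c, σ c = c := fun c => (smul_left_injective F hv0 (hv c)).symm
    refine ⟨h.val, hhu, fun g hg => congrArg Units.val (hS.commute hg hh), fun c z => by rw [hσ],
      fun a => ⟨-(Matrix.vecMul a h.val), fun z => ?_⟩⟩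
    simp [twistedForm, hσ, Matrix.dotProduct_mulVec]

lemma fst_vecMul_embeddedGL (r x : Fin 3 → TruncSkewPoly σ) (g : GL (Fin 3) F) :
    fst σ (r ⬝ᵥ embeddedGL σ g x) = dotForm (vfst σ r) (g.val.mulVec (vfst σ x)) := by
  rw [← vfst_embeddedGL]
  simp [dotForm, dotProduct, vfst, -vfst_embeddedGL]

lemma snd_vecMul_embeddedGL (r x : Fin 3 → TruncSkewPoly σ) (g : GL (Fin 3) F)
    {H : Matrix (Fin 3) (Fin 3) F} (hH : H.mulVec (vfst σ x) = vsnd σ x)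
    (hg : g.val * H = H * g.val) :
    snd σ (r ⬝ᵥ embeddedGL σ g x) =
      twistedForm σ H (vfst σ r) (vsnd σ r) (g.val.mulVec (vfst σ x)) := by
  have h : H.mulVec (g.val.mulVec (vfst σ x)) = vsnd σ (embeddedGL σ g x) := by
    rw [vsnd_embeddedGL, Matrix.mulVec_mulVec, ← hg, ← Matrix.mulVec_mulVec, hH]
  change _ = _ ⬝ᵥ H.mulVec _ + _ ⬝ᵥ _
  rw [h, ← vfst_embeddedGL]
  simp [dotProduct, vfst, vsnd, Finset.sum_add_distrib]

/-- The column representatives run once through the points of the plane, so their nonzero multiples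
run once through F³ \ {0}. The entry weight is constant on such multiples and zero at z = 0. -/
lemma card_sub_one_mul_wordWeight [Fintype F] {S : Subgroup PGL(3, F)} (hS : IsSingerCycle S)
    {x : Fin 3 → TruncSkewPoly σ} (hx : vfst σ x ≠ 0)
    (hv : ∀ c : F, c • vsnd σ x = σ c • vsnd σ x)
    {H : Matrix (Fin 3) (Fin 3) F} (hHx : H.mulVec (vfst σ x) = vsnd σ x)
    (hHg : ∀ g ∈ liftGL S, g.val * H = H * g.val)
    (hH : ∀ (c : F) (z : Fin 3 → F), c • H.mulVec z = σ c • H.mulVec z) {n : ℕ}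
    (hn : n = Nat.card F ^ 2 + Nat.card F + 1)
    {Y : Matrix (Fin 3) (Fin n) (TruncSkewPoly σ)}
    (hY : Set.BijOn (fun j => Submodule.span (TruncSkewPoly σ)ᵐᵒᵖ {Y.col j}) Set.univ
        (embeddedOrbit σ S (Submodule.span _ {x}))) (r : Fin 3 → TruncSkewPoly σ) :
    ((Nat.card F : ℝ) - 1) * wordWeight (homWeight σ) (Matrix.vecMul r Y) =
      formSum σ 1 (Nat.card F / ((Nat.card F : ℝ) - 1)) H (vfst σ r) (vsnd σ r) := by
  classical
  have hcol : ∀ j, ∃ g : liftGL S, Submodule.span (TruncSkewPoly σ)ᵐᵒᵖ {embeddedGL σ g.1 x} =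
      Submodule.span (TruncSkewPoly σ)ᵐᵒᵖ {Y.col j} := by
    intro j
    have := hY.mapsTo (Set.mem_univ j)
    rwa [embeddedOrbit_span] at this
  choose g hg using hcol
  have hs : ∀ j, ∃ s : TruncSkewPoly σ, fst σ s ≠ 0 ∧
      embeddedGL σ (g j).1 x = MulOpposite.op s • Y.col j := by
    intro j
    obtain ⟨s, hs⟩ := exists_op_smul_eq σ (hg j)
    refine ⟨s, fun h0 => ?_, hs⟩
    have h := congrArg (vfst σ) hs
    rw [vfst_op_smul, h0, zero_smul, vfst_embeddedGL] at h
    exact mulVec_ne_zero _ hx h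
  choose s hs0 hs using hs
  let z : Fin n → Fin 3 → F := fun j => (g j).1.val.mulVec (vfst σ x)
  have hz : ∀ j, z j ≠ 0 := fun j => mulVec_ne_zero _ hx
  let ω : (Fin 3 → F) → ℝ := fun y =>
    stepWeight 1 (Nat.card F / ((Nat.card F : ℝ) - 1)) (dotForm (vfst σ r) y)
      (twistedForm σ H (vfst σ r) (vsnd σ r) y)
  have hω : ∀ (c : Fˣ) y, ω (c.val • y) = ω y := fun c y =>
    stepWeight_congr _ _ (by simp [dotForm_smul]) (by simp [twistedForm_smul σ hH])
  have hword : ∀ j, homWeight σ (Matrix.vecMul r Y j) = ω (z j) := by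
    intro j
    rw [← homWeight_mul_of_fst_ne_zero σ _ (hs0 j)]
    have : Matrix.vecMul r Y j * s j = r ⬝ᵥ embeddedGL σ (g j).1 x := by
      rw [hs]
      simp [Matrix.vecMul, dotProduct, Finset.sum_mul, mul_assoc]
    rw [this, homWeight, fst_vecMul_embeddedGL,
      snd_vecMul_embeddedGL σ r x _ hHx (hHg _ (g j).2)]
  let e : Fˣ × Fin n → {y : Fin 3 → F // y ≠ 0} := fun k =>
    ⟨k.1.val • z k.2, smul_ne_zero k.1.ne_zero (hz k.2)⟩
  have he : Function.Injective e := by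
    rintro ⟨c, i⟩ ⟨d, j⟩ h
    have h' : c.val • z i = d.val • z j := congrArg Subtype.val h
    have hij : i = j := by
      refine hY.injOn (Set.mem_univ i) (Set.mem_univ j) ?_
      rw [← hg, ← hg]
      refine span_eq_of_orbitProj_eq σ hS hx hv ?_
      refine (Projectivization.mk_eq_mk_iff' _ _ _ _ _).mpr ⟨c.val⁻¹ * d.val, ?_⟩
      change _ • z j = z i
      rw [mul_smul, ← h', smul_smul]
      simp
    subst hij
    rw [Units.ext (smul_left_injective F (hz i) h')]
  have hcard : Fintype.card (Fˣ × Fin n) = Fintype.card {y : Fin 3 → F // y ≠ 0} := by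
    rw [Fintype.card_prod, Fintype.card_units, Fintype.card_subtype_compl]
    simp only [Fintype.card_fin, Fintype.card_pi, Finset.prod_const, Finset.card_univ,
      Fintype.card_unique, hn, Nat.card_eq_fintype_card]
    obtain ⟨m, hm⟩ := Nat.exists_eq_add_of_lt (Fintype.card_pos (α := F))
    rw [hm]
    simp only [zero_add, Nat.add_sub_cancel]
    rw [eq_tsub_iff_add_eq_of_le (Nat.one_le_pow _ _ (Nat.succ_pos m)), Nat.succ_eq_add_one]
    ring
  have hbij : Function.Bijective e := (Fintype.bijective_iff_injective_and_card e).mpr ⟨he, hcard⟩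
  have h0 : ω 0 = 0 := by simp [ω]
  calc ((Nat.card F : ℝ) - 1) * wordWeight (homWeight σ) (Matrix.vecMul r Y)
      = ∑ k : Fˣ × Fin n, ω (e k).1 := by
        rw [Fintype.sum_prod_type]
        simp only [e, hω, wordWeight, hword, Finset.sum_const, Finset.card_univ,
          Fintype.card_units, nsmul_eq_mul, Nat.card_eq_fintype_card,
          Nat.cast_pred (Fintype.card_pos (α := F))]
    _ = ∑ y : {y : Fin 3 → F // y ≠ 0}, ω y.1 :=
        Fintype.sum_bijective e hbij _ _ fun _ => rfl
    _ = ∑ y, ω y := by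
        rw [← Finset.sum_subtype (Finset.univ.erase 0) (by simp) ω, Finset.sum_erase _ h0]
    _ = _ := rfl

lemma mem_rowCode_iff {R : Type*} [Ring R] {k n : ℕ} (Y : Matrix (Fin k) (Fin n) R)
    (c : Fin n → R) : c ∈ rowCode Y ↔ ∃ r, Matrix.vecMul r Y = c := by
  rw [rowCode, Submodule.mem_span_range_iff_exists_fun]
  simp only [Matrix.vecMul_eq_sum]
  rfl

end TruncSkewPoly

/-! ### The theorem -/

open TruncSkewPoly

theorem mainTheorem4 {F : Type*} [Field F] [Finite F] (q : ℕ) (hq : Nat.card F = q)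
    (σ : F ≃+* F) (S : Subgroup PGL(3, F)) (hS : IsSingerCycle S)
    (p : Submodule (TruncSkewPoly σ)ᵐᵒᵖ (Fin 3 → TruncSkewPoly σ))
    (hp : p ∈ barbPoints (TruncSkewPoly σ) (Fin 3 → TruncSkewPoly σ)) :
    -- the orbit is a set of `q ^ 2 + q + 1` points of the Barbilian space exactly if `σ` is the
    -- identity or the point is generated by a vector over `F`
    embeddedOrbit σ S p ⊆ barbPoints (TruncSkewPoly σ) (Fin 3 → TruncSkewPoly σ) ∧
    ((embeddedOrbit σ S p).ncard = q ^ 2 + q + 1 ↔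
      σ = RingEquiv.refl F ∨
        ∃ v : Fin 3 → F, p = Submodule.span (TruncSkewPoly σ)ᵐᵒᵖ
          {fun i => TruncSkewPoly.const σ (v i)}) ∧
    -- the normalized homogeneous weight exists and is unique
    (∃! w : TruncSkewPoly σ → ℝ, IsNormalizedHomogeneousWeight w) ∧
    -- a matrix whose columns generate the points of the orbit, each point once
    ∀ Y : Matrix (Fin 3) (Fin (q ^ 2 + q + 1)) (TruncSkewPoly σ),
      Set.BijOn (fun j => Submodule.span (TruncSkewPoly σ)ᵐᵒᵖ {Y.col j}) Set.univ
        (embeddedOrbit σ S p) →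
      LinearIndependent (TruncSkewPoly σ) Y.row ∧
      ∀ w : TruncSkewPoly σ → ℝ, IsNormalizedHomogeneousWeight w →
        IsTwoWeightCode w (rowCode Y) ((q : ℝ) ^ 3 / ((q : ℝ) - 1)) ((q : ℝ) ^ 2) := by
  subst hq
  have hcard := ncard_embeddedOrbit_iff σ hS hp
  refine ⟨embeddedOrbit_subset_barbPoints σ S hp, hcard,
    ⟨homWeight σ, isNormalizedHomogeneousWeight_homWeight σ,
      fun _ => eq_homWeight σ⟩, fun Y hY => ?_⟩
  have := Fintype.ofFinite F
  have hgood := hcard.mp <| by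
    rw [← hY.image_eq, hY.injOn.ncard_image, Set.ncard_univ, Nat.card_fin]
  obtain ⟨x, rfl, hx, hv⟩ := exists_generator σ hp hgood
  obtain ⟨H, hHx, hHg, hH, hHb⟩ := exists_commuting_matrix σ hS hx hv
  have hq1 := card_sub_one_pos F
  have hq0 : (0 : ℝ) < Nat.card F := by linarith
  have hw := card_sub_one_mul_wordWeight σ hS hx hv hHx hHg hH rfl hY
  set Q : ℝ := (Nat.card F : ℝ) with hQ
  have hw₁ : ∀ {r}, formSum σ 1 (Q / (Q - 1)) H (vfst σ r) (vsnd σ r) = Q ^ 3 →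
      wordWeight (homWeight σ) (Matrix.vecMul r Y) = Q ^ 3 / (Q - 1) := fun {r} h => by
    rw [eq_div_iff hq1.ne', mul_comm, hw, h]
  have hw₂ : ∀ {r}, vfst σ r ≠ 0 →
      (∀ z, dotForm (vfst σ r) z = 0 → twistedForm σ H (vfst σ r) (vsnd σ r) z = 0) →
      wordWeight (homWeight σ) (Matrix.vecMul r Y) = Q ^ 2 := fun {r} ha h => by
    apply mul_left_cancel₀ hq1.ne'
    rw [hw, formSum_of_ker_le σ _ _ H ha h]
    ring
  have hzero : ∀ {r}, vfst σ r = 0 → vsnd σ r ≠ 0 →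
      wordWeight (homWeight σ) (Matrix.vecMul r Y) = Q ^ 3 / (Q - 1) := fun {r} ha hb => by
    apply hw₁
    rw [ha, formSum_zero_left σ _ _ H hb, ← hQ, mul_div_cancel₀ _ hq1.ne']
    ring
  have hvalues : ∀ r : Fin 3 → TruncSkewPoly σ, r ≠ 0 →
      wordWeight (homWeight σ) (Matrix.vecMul r Y) = Q ^ 3 / (Q - 1) ∨
        wordWeight (homWeight σ) (Matrix.vecMul r Y) = Q ^ 2 := by
    intro r hr
    by_cases ha : vfst σ r = 0
    · refine Or.inl (hzero ha fun hb => hr (vext ?_ ?_))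
      · rw [ha]; ext i; simp [vfst]
      · rw [hb]; ext i; simp [vsnd]
    · by_cases h : ∀ z, dotForm (vfst σ r) z = 0 → twistedForm σ H (vfst σ r) (vsnd σ r) z = 0
      · exact Or.inr (hw₂ ha h)
      · refine Or.inl (hw₁ ?_)
        rw [formSum_of_not_ker_le σ _ _ hH ha h, ← hQ, mul_div_cancel₀ _ hq1.ne']
        ring
  have hpos : ∀ r : Fin 3 → TruncSkewPoly σ, r ≠ 0 →
      0 < wordWeight (homWeight σ) (Matrix.vecMul r Y) := fun r hr => by
    rcases hvalues r hr with h | h <;> rw [h] <;> positivity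
  have hword0 : wordWeight (homWeight σ) (0 : Fin (Nat.card F ^ 2 + Nat.card F + 1) → _) = 0 := by
    simp [wordWeight, homWeight]
  refine ⟨?_, fun w hw => ?_⟩
  · rw [Fintype.linearIndependent_iff]
    intro r hr
    have hr0 : Matrix.vecMul r Y = 0 := by
      rw [Matrix.vecMul_eq_sum]
      exact hr
    by_contra! hne
    obtain ⟨i, hi⟩ := hne
    have := hpos r (Function.ne_iff.mpr ⟨i, hi⟩)
    rw [hr0, hword0] at this
    exact this.false
  · obtain rfl := eq_homWeight σ hw
    refine ⟨fun c hc hc0 => ?_, fun h => ?_, Set.ext fun t => ⟨?_, ?_⟩⟩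
    · obtain ⟨r, rfl⟩ := (mem_rowCode_iff Y c).mp hc
      exact hpos r fun h => hc0 (by rw [h, Matrix.zero_vecMul])
    -- Equal weights would give q³ = q²(q - 1).
    · rw [div_eq_iff hq1.ne'] at h
      have : Q ^ 2 = 0 := by linear_combination h
      exact (pow_pos hq0 2).ne' this
    · rintro ⟨ht, c, hc, rfl⟩
      obtain ⟨r, rfl⟩ := (mem_rowCode_iff Y c).mp hc
      refine hvalues r fun h => ht ?_
      rw [h, Matrix.zero_vecMul, hword0]
    · have h1 : (fun _ => 1 : Fin 3 → F) ≠ 0 := fun h => one_ne_zero (congrFun h 0)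
      rintro (rfl | rfl)
      · refine ⟨by positivity, _, (mem_rowCode_iff Y _).mpr ⟨fun i => pair σ 0 1, rfl⟩, ?_⟩
        exact hzero (vfst_pair σ 0 fun _ => 1) ((vsnd_pair σ 0 fun _ => 1).trans_ne h1)
      -- The weight q² is attained by taking a = (1, 1, 1) and the b that makes the X-part vanish
      -- identically.
      · obtain ⟨b, hb⟩ := hHb fun _ => 1
        refine ⟨by positivity, _, (mem_rowCode_iff Y _).mpr ⟨fun i => pair σ 1 (b i), rfl⟩, ?_⟩
        refine hw₂ ((vfst_pair σ (fun _ => 1) b).trans_ne h1) fun z _ => ?_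
        rw [vfst_pair σ (fun _ => 1) b, vsnd_pair σ (fun _ => 1) b, hb]
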